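/- A semi-Markovian graph (SMG) $G$ on a finite set $V$ of observed vertices consists of an acyclic set of directed edges $v\to w$ together with bidirected edges $v\leftrightarrow w$ between distinct vertices. For $K\subseteq V$, $G[K]$ is the induced subgraph (directed and bidirected edges), and $\mathrm{An}(K)_G$ is $K$ together with its ancestors. $\mathrm{Co}(K)_G$ is the set of vertices joined to $K$ by a path of directed or bidirected edges whose orientation is ignored, including $K$. $G_{\overline X}$ is $G$ with every edge having an arrowhead into $X$ removed (so bidirected edges at $X$ are removed too). The latent projection $L(G,K)$ is the SMG on $K$ in which $v\to w$ if and only if $G$ has a directed path from $v$ to $w$ with all intermediate vertices in $V\setminus K$, and, for $v\ne w$, $v\leftrightarrow w$ if and only if $G$ has a collider-free path between $v$ and $w$ with all intermediate vertices in $V\setminus K$ whose end edges have arrowheads into $v$ and into $w$. A causal model inducing $G$ has nonempty countable domains for the observed variables, finitely many mutually independent exogenous variables, and for each $v\in V$ a function giving the value of $v$ from its parents in $G$ and its exogenous parents, such that $v\leftrightarrow w$ in $G$ exactly when $v\neq w$ have a common exogenous parent. (Thus $G$ is the latent projection of the causal diagram; semi-Markovian models are those in which each exogenous variable has at most two children.)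 $P(V)$ is the law of the observed variables, and $P_x(y)$ is the probability of $Y=y$ after the functions of the variables in $X$ have been replaced by the constants $x$. The effect $P_x(y)$ is identifiable in $G$ if any two causal models inducing $G$ with the same domains and the same positive $P(V)$ have the same $P_x(y)$ for all $x,y$. **Corollary.** Let $G$ be an SMG on $V$, let $X,Y\subseteq V$ be disjoint, and let $Z=\mathrm{An}(Y)_G\setminus \mathrm{Co}(Y)_{G_{\overline X}}$. If $G[V\setminus Z]=L(G,V\setminus Z)$, then $Z$ can be removed from $G$ when the causal effect $P_x(y)$ is considered, that is, $P_x(y)$ obtained from $P$ in $G$ equals $P'_{x\setminus z}(y)$ obtained from $P'=P(V\setminus Z)$ in $G[V\setminus Z]$, where $x\setminus z$ is the restriction of $x$ to $X\setminus Z$. Precisely, $Y\cap Z=\emptyset$ and: 1. For every causal model inducing $G$, with observed distribution $P$ and causal effect $P_x(y)$, there is a causal model inducing $G[V\setminus Z]$ over the same domains with observed distribution $P'=P(V\setminus Z)$ and with $P'_{x\setminus z}(y)=P_x(y)$ for all $x,y$. 2. $P_x(y)$ is identifiable in $G$ if and only if $P'_{x\setminus z}(y)$ is identifiable in $G[V\setminus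 Z]$. 3. If these effects are identifiable, then for every causal model inducing $G$ and every causal model inducing $G[V\setminus Z]$ over the same domains whose observed distribution $P'$ is positive and equals $P(V\setminus Z)$, one has $P_x(y)=P'_{x\setminus z}(y)$ for all $x,y$. -/

import Mathlib

open MeasureTheory
open scoped ENNReal

universe u

/-- A semi-Markovian graph on the observed vertices `V`: directed edges `dir v w` (`v → w`) forming
an acyclic graph, together with bidirected edges `bi v w` (`v ↔ w`) between distinct vertices. -/
structure SMG (V : Type u) where
  dir : V → V → Prop
  bi : V → V → Prop
  acyclic : ∀ v, ¬ Relation.TransGen dir v v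
  bi_symm : ∀ v w, bi v w → bi w v
  bi_irrefl : ∀ v, ¬ bi v v

namespace SMG

variable {V : Type u}

/-- `An(W)`: the vertices of `W` and their ancestors. -/
def An (G : SMG V) (W : Set V) : Set V :=
  {v | ∃ w ∈ W, Relation.ReflTransGen G.dir v w}

/-- Two vertices are adjacent if some edge joins them, whatever its kind or direction. -/
def Adj (G : SMG V) (v w : V) : Prop :=
  G.dir v w ∨ G.dir w v ∨ G.bi v w

/-- `Co(W)`: the vertices connected to `W` by a path on which the directionality of the edges is
ignored, including `W` itself. -/
def Co (G : SMG V) (W : Set V) : Set V :=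
  {v | ∃ w ∈ W, Relation.ReflTransGen G.Adj w v}

/-- The graph obtained from `G` by removing all edges with an arrowhead into `X`: the directed
edges into `X` and the bidirected edges having an endpoint in `X`. -/
def removeIncoming (G : SMG V) (X : Set V) : SMG V where
  dir v w := G.dir v w ∧ w ∉ X
  bi v w := G.bi v w ∧ v ∉ X ∧ w ∉ X
  acyclic v h := G.acyclic v (h.lift id fun _ _ h' => h'.1)
  bi_symm v w h := ⟨G.bi_symm v w h.1, h.2.2, h.2.1⟩
  bi_irrefl v h := G.bi_irrefl v h.1

/-- The induced subgraph `G[K]`; it retains all directed and bidirected edges inside `K`. -/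
def induce (G : SMG V) (K : Set V) : SMG K where
  dir v w := G.dir v w
  bi v w := G.bi v w
  acyclic v h := G.acyclic v (h.lift Subtype.val fun _ _ h' => h')
  bi_symm v w h := G.bi_symm v w h
  bi_irrefl v h := G.bi_irrefl v h

/-- `G.DirPath L a b`: there is a directed path `a → ⋯ → b`, with at least one edge, all of whose
intermediate vertices lie in `L`. -/
inductive DirPath (G : SMG V) (L : Set V) : V → V → Prop
  | edge {a b : V} : G.dir a b → DirPath G L a b
  | cons {a c b : V} : G.dir a c → c ∈ L → DirPath G L c b → DirPath G L a b

/-- The way in which an edge is traversed along a path: `a → b`, `a ← b` or `a ↔ b`. -/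
inductive Mark
  | fwd
  | bwd
  | bid

/-- There is an edge between `a` and `b` which reads as the given mark when going from `a`
to `b`. -/
def Edge (G : SMG V) : Mark → V → V → Prop
  | .fwd, a, b => G.dir a b
  | .bwd, a, b => G.dir b a
  | .bid, a, b => G.bi a b

/-- The edge has an arrowhead at the vertex from which it is traversed. -/
def Mark.headAtStart : Mark → Prop
  | .fwd => False
  | .bwd => True
  | .bid => True

/-- The edge has an arrowhead at the vertex to which it is traversed. -/
def Mark.headAtEnd : Mark → Prop
  | .fwd => True
  | .bwd => False
  | .bid => True

/-- `G.NoColliderPath L m a b l`: there is a path from `a` to `b` without colliders, all of whose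
intermediate vertices lie in `L`, whose first edge is traversed as `m` and whose last edge is
traversed as `l`. Repetitions of vertices are harmless: when `a` and `b` are distinct and not in
`L`, a path with arrowheads at both ends may be shortened to one without repetitions. -/
inductive NoColliderPath (G : SMG V) (L : Set V) : Mark → V → V → Mark → Prop
  | edge {m : Mark} {a b : V} : G.Edge m a b → NoColliderPath G L m a b m
  | cons {m m' l : Mark} {a c b : V} : G.Edge m a c → c ∈ L →
      ¬ (m.headAtEnd ∧ m'.headAtStart) →
      NoColliderPath G L m' c b l → NoColliderPath G L m a b l

theorem DirPath.transGen {G : SMG V} {L : Set V} {a b : V} (h : G.DirPath L a b) :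
    Relation.TransGen G.dir a b := by
  induction h with
  | edge h => exact .single h
  | cons h _ _ ih => exact .head h ih

/-- Reversal of the mark of an edge. -/
def Mark.flip : Mark → Mark
  | .fwd => .bwd
  | .bwd => .fwd
  | .bid => .bid

theorem Mark.headAtStart_flip (m : Mark) : m.flip.headAtStart ↔ m.headAtEnd := by
  cases m <;> simp [Mark.flip, Mark.headAtStart, Mark.headAtEnd]

theorem Mark.headAtEnd_flip (m : Mark) : m.flip.headAtEnd ↔ m.headAtStart := by
  cases m <;> simp [Mark.flip, Mark.headAtStart, Mark.headAtEnd]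

theorem Edge.flip {G : SMG V} {m : Mark} {a b : V} (h : G.Edge m a b) : G.Edge m.flip b a := by
  cases m
  · exact h
  · exact h
  · exact G.bi_symm _ _ h

theorem NoColliderPath.snoc {G : SMG V} {L : Set V} {m l l' : Mark} {a c b : V}
    (h : G.NoColliderPath L m a c l) (hc : c ∈ L) (hl : ¬ (l.headAtEnd ∧ l'.headAtStart))
    (he : G.Edge l' c b) : G.NoColliderPath L m a b l' := by
  induction h with
  | edge h => exact .cons h hc hl (.edge he)
  | cons h hd hn _ ih => exact .cons h hd hn (ih hc hl he)

theorem NoColliderPath.reverse {G : SMG V} {L : Set V} {m l : Mark} {a b : V}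
    (h : G.NoColliderPath L m a b l) : G.NoColliderPath L l.flip b a m.flip := by
  induction h with
  | edge h => exact .edge h.flip
  | cons h hc hn _ ih =>
    refine ih.snoc hc ?_ h.flip
    rw [Mark.headAtEnd_flip, Mark.headAtStart_flip]
    exact fun h' => hn ⟨h'.2, h'.1⟩

/-- The latent projection `L(G, K)`: the vertices outside `K` are treated as latent (a bidirected
edge of `G` stands for a further latent vertex with two children). There is an edge `v → w` if
there is a directed path from `v` to `w` through latent vertices, and for distinct `v`, `w` an edge
`v ↔ w` if there is a path between them through latent vertices that has no collider, and whose
first and last edges have arrowheads into `v` and into `w`. -/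
def latentProjection (G : SMG V) (K : Set V) : SMG K where
  dir v w := G.DirPath Kᶜ v w
  bi v w := v ≠ w ∧ ∃ m l : Mark, m.headAtStart ∧ l.headAtEnd ∧ G.NoColliderPath Kᶜ m v w l
  acyclic v h := by
    have h' : Relation.TransGen (Relation.TransGen G.dir) (v : V) v :=
      h.lift Subtype.val fun _ _ hp => hp.transGen
    rw [Relation.transGen_eq_self] at h'
    exact G.acyclic v h'
  bi_symm v w h := by
    obtain ⟨hne, m, l, hm, hl, hp⟩ := h
    exact ⟨hne.symm, l.flip, m.flip, (Mark.headAtStart_flip l).2 hl,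
      (Mark.headAtEnd_flip m).2 hm, hp.reverse⟩
  bi_irrefl v h := h.1 rfl

theorem wellFounded_dir [Finite V] (G : SMG V) : WellFounded G.dir := by
  have : Std.Irrefl (Relation.TransGen G.dir) := ⟨G.acyclic⟩
  have h : WellFounded (Relation.TransGen G.dir) := Finite.wellFounded_of_trans_of_irrefl _
  exact Subrelation.wf (fun h' => Relation.TransGen.single h') h

end SMG

/-- A probabilistic causal model with mutually independent exogenous variables that induces the
semi-Markovian graph `G` and whose observed variables have the domains `D v`.

`ι` indexes the exogenous variables; `child i` is the set of observed variables whose functions are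
defined in terms of the `i`-th one. The function of `v` takes as arguments the observed parents of
`v` in `G` and the exogenous variables of which `v` is a child. The last field says that `v ↔ w` is
an edge of `G` exactly if `v` and `w` have a common exogenous parent, i.e. that `G` is the latent
projection of the causal diagram of the model to the observed variables. -/
structure CausalModel {V : Type u} (G : SMG V) (D : V → Type) where
  ι : Type u
  [fintypeIndex : Fintype ι]
  child : ι → Set V
  Ω : ι → Type
  [measurableSpaceΩ : ∀ i, MeasurableSpace (Ω i)]
  law : ∀ i, Measure (Ω i)
  [isProbabilityMeasure_law : ∀ i, IsProbabilityMeasure (law i)]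
  f : ∀ v, (∀ p : {p // G.dir p v}, D p) → (∀ i : {i // v ∈ child i}, Ω i) → D v
  measurable_f : ∀ v pa d, MeasurableSet {ω | f v pa ω = d}
  bi_iff : ∀ v w, v ≠ w → (G.bi v w ↔ ∃ i, v ∈ child i ∧ w ∈ child i)

namespace CausalModel

attribute [instance] fintypeIndex measurableSpaceΩ isProbabilityMeasure_law

variable {V : Type u} {G : SMG V} {D : V → Type}

/-- The joint law of the (mutually independent) exogenous variables. -/
noncomputable def exoLaw (M : CausalModel G D) : Measure (∀ i, M.Ω i) :=
  Measure.pi M.law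

open Classical in
/-- The values of the observed variables in the submodel `M_x`, in which the functions of the
variables in `X` are replaced by the constants `x v` (only the values of `x` on `X` are used), for
the value `ω` of the exogenous variables. -/
noncomputable def value [Finite V] (M : CausalModel G D) (X : Set V) (x : ∀ v, D v)
    (ω : ∀ i, M.Ω i) : ∀ v, D v :=
  G.wellFounded_dir.fix fun v ih =>
    if v ∈ X then x v else M.f v (fun p => ih p p.2) (fun i => ω i)

open Classical in
theorem value_eq [Finite V] (M : CausalModel G D) (X : Set V) (x : ∀ v, D v)
    (ω : ∀ i, M.Ω i) (v : V) :
    M.value X x ω v =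
      if v ∈ X then x v else M.f v (fun p => M.value X x ω p) (fun i => ω i) := by
  unfold value
  rw [WellFounded.fix_eq]

/-- The causal effect `P_x(y)`: the probability that `Y = y` in the submodel `M_x`. Only the values
of `x` on `X` and those of `y` on `Y` are used. -/
noncomputable def effect [Finite V] (M : CausalModel G D) (X : Set V) (x : ∀ v, D v)
    (Y : Set V) (y : ∀ v, D v) : ℝ≥0∞ :=
  M.exoLaw {ω | ∀ v ∈ Y, M.value X x ω v = y v}

/-- The observational probability `P(S = s)`: no variable is intervened on, so that the first `s`
below plays no role. -/
noncomputable def prob [Finite V] (M : CausalModel G D) (S : Set V) (s : ∀ v, D v) : ℝ≥0∞ :=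
  M.effect ∅ s S s

end CausalModel

namespace SMG

variable {V : Type u}

/-- The causal effect of `X` on `Y` is identifiable in `G`: it is determined by the (positive)
joint distribution `P(V)` of the observed variables in all causal models that induce `G`. -/
def Identifiable [Finite V] (G : SMG V) (X Y : Set V) : Prop :=
  ∀ (D : V → Type) [∀ v, Countable (D v)] [∀ v, Nonempty (D v)] (M₁ M₂ : CausalModel G D),
    (∀ s, M₁.prob Set.univ s = M₂.prob Set.univ s) → (∀ s, 0 < M₁.prob Set.univ s) →
    ∀ x y, M₁.effect X x Y y = M₂.effect X x Y y

/-- `Z` can be removed from `G` when the causal effect `P_x(y)` is considered: `P_x(y)` obtained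
from `P` in `G` is the same as `P'_{x ∖ z}(y)` obtained from `P' = P(V ∖ Z)` in `G[V ∖ Z]`. -/
def CanBeRemoved [Finite V] (G : SMG V) (X Y Z : Set V) : Prop :=
  Y ⊆ Zᶜ ∧
  -- every model of `G` has a counterpart inducing `G[V ∖ Z]`, with observed distribution
  -- `P' = P(V ∖ Z)` and the same causal effect
  (∀ (D : V → Type) [∀ v, Countable (D v)] [∀ v, Nonempty (D v)] (M : CausalModel G D),
    ∃ M' : CausalModel (G.induce Zᶜ) (fun k => D k),
      (∀ s : ∀ v, D v, M'.prob Set.univ (fun k => s k) = M.prob Zᶜ s) ∧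
      ∀ x y : ∀ v, D v,
        M.effect X x Y y =
          M'.effect (Subtype.val ⁻¹' X) (fun k => x k) (Subtype.val ⁻¹' Y) (fun k => y k)) ∧
  -- the effect is identifiable from `P` in `G` if and only if it is from `P'` in `G[V ∖ Z]`
  (G.Identifiable X Y ↔
    (G.induce Zᶜ).Identifiable (Subtype.val ⁻¹' X) (Subtype.val ⁻¹' Y)) ∧
  -- if so, the effect obtained from `P'` in `G[V ∖ Z]` is the one obtained from `P` in `G`
  (G.Identifiable X Y →
    ∀ (D : V → Type) [∀ v, Countable (D v)] [∀ v, Nonempty (D v)] (M : CausalModel G D)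
      (M' : CausalModel (G.induce Zᶜ) (fun k => D k)),
      (∀ s : ∀ v, D v, M'.prob Set.univ (fun k => s k) = M.prob Zᶜ s) →
      (∀ s, 0 < M'.prob Set.univ s) →
      ∀ x y : ∀ v, D v,
        M.effect X x Y y =
          M'.effect (Subtype.val ⁻¹' X) (fun k => x k) (Subtype.val ⁻¹' Y) (fun k => y k))

end SMG

/-!
Let `K` be the complement of `Z`. In `G.removeIncoming X`, `An(Y)` is contained in `Co(Y)`, so it is
contained in `K`; hence intervening on `X ∖ K` does not affect `Y`, and `P_x(y)` is an effect among
the variables in `K`.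

A model of `G` projects to a model of `L(G, K)`: substitute the functions of the variables outside
`K` into those of their children. This keeps `P(K)` and all causal effects among the variables in
`K`, so identifiability in `L(G, K)` implies identifiability in `G`. Conversely, a model of `G[K]`
extends to a model of `G` by letting the variables outside `K` be independent noise which the
variables in `K` ignore. This multiplies `P'` by a positive factor and keeps all effects, so
identifiability in `G` implies identifiability in `G[K]`. When `G[K] = L(G, K)`, both apply.
-/

section DependentFunctions

/-- The extension of a dependent function from a subtype to the whole type, with arbitrary values
elsewhere. It supplies arguments on which a causal function does not depend. -/
noncomputable def extendPi {ι : Type*} {α : ι → Type*} [∀ i, Nonempty (α i)] (p : ι → Prop)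
    (f : ∀ i : {i // p i}, α i) (i : ι) : α i :=
  open Classical in if h : p i then f ⟨i, h⟩ else Classical.arbitrary (α i)

theorem extendPi_of_pos {ι : Type*} {α : ι → Type*} [∀ i, Nonempty (α i)] {p : ι → Prop}
    (f : ∀ i : {i // p i}, α i) {i : ι} (h : p i) : extendPi p f i = f ⟨i, h⟩ :=
  dif_pos h

theorem measurable_extendPi {ι : Type*} {α : ι → Type*} [∀ i, Nonempty (α i)]
    [∀ i, MeasurableSpace (α i)] (p : ι → Prop) : Measurable (extendPi (α := α) p) := by
  refine measurable_pi_iff.2 fun i => ?_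
  by_cases h : p i
  · simp only [extendPi_of_pos _ h]
    exact measurable_pi_apply _
  · simp only [extendPi, dif_neg h]
    exact measurable_const

theorem exists_countable_nonempty_extension {ι : Type*} {p : ι → Prop} (D : Subtype p → Type)
    [∀ i, Countable (D i)] [∀ i, Nonempty (D i)] :
    ∃ D' : ι → Type, (fun i : Subtype p => D' i) = D ∧
      (∀ i, Countable (D' i)) ∧ ∀ i, Nonempty (D' i) := by
  have : Nonempty {T : Type // Countable T ∧ Nonempty T} := ⟨Unit, inferInstance, inferInstance⟩
  obtain ⟨D', hD'⟩ := Subtype.exists_pi_extension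
    (α := fun _ : ι => {T : Type // Countable T ∧ Nonempty T}) (p := p)
    fun i => ⟨D i, inferInstance, inferInstance⟩
  exact ⟨fun i => (D' i).1, funext fun i => congrArg Subtype.val (congrFun hD' i),
    fun i => (D' i).2.1, fun i => (D' i).2.2⟩

end DependentFunctions

section SumLaw

variable {ι κ : Type*} {Ω : ι → Type u} {Ω' : κ → Type u} [∀ i, MeasurableSpace (Ω i)]
  [∀ j, MeasurableSpace (Ω' j)]

instance measurableSpaceSumElim : ∀ i, MeasurableSpace (Sum.elim Ω Ω' i)
  | .inl i => inferInstanceAs (MeasurableSpace (Ω i))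
  | .inr j => inferInstanceAs (MeasurableSpace (Ω' j))

/-- The family of laws obtained by joining two families; it is used to add exogenous variables to
a causal model. -/
noncomputable def sumLaw (μ : ∀ i, Measure (Ω i)) (ν : ∀ j, Measure (Ω' j)) :
    ∀ i, Measure (Sum.elim Ω Ω' i)
  | .inl i => μ i
  | .inr j => ν j

instance isProbabilityMeasure_sumLaw (μ : ∀ i, Measure (Ω i)) (ν : ∀ j, Measure (Ω' j))
    [∀ i, IsProbabilityMeasure (μ i)] [∀ j, IsProbabilityMeasure (ν j)] :
    ∀ i, IsProbabilityMeasure (sumLaw μ ν i)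
  | .inl i => inferInstanceAs (IsProbabilityMeasure (μ i))
  | .inr j => inferInstanceAs (IsProbabilityMeasure (ν j))

theorem pi_sumLaw [Fintype ι] [Fintype κ] (μ : ∀ i, Measure (Ω i)) (ν : ∀ j, Measure (Ω' j))
    [∀ i, SigmaFinite (μ i)] [∀ j, SigmaFinite (ν j)] (A : Set (∀ i, Ω i)) (B : Set (∀ j, Ω' j)) :
    Measure.pi (sumLaw μ ν) {ω | (fun i => ω (.inl i)) ∈ A ∧ (fun j => ω (.inr j)) ∈ B} =
      Measure.pi μ A * Measure.pi ν B := by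
  have : ∀ i, SigmaFinite (sumLaw μ ν i)
    | .inl i => inferInstanceAs (SigmaFinite (μ i))
    | .inr j => inferInstanceAs (SigmaFinite (ν j))
  exact ((measurePreserving_sumPiEquivProdPi (sumLaw μ ν)).measure_preimage_equiv (A ×ˢ B)).trans
    (Measure.prod_prod (μ := Measure.pi μ) (ν := Measure.pi ν) A B)

end SumLaw

namespace SMG

variable {V : Type u} {G : SMG V} {K L : Set V} {a b u v w : V} {m l : Mark}

theorem subset_An (G : SMG V) (W : Set V) : W ⊆ G.An W :=
  fun v hv => ⟨v, hv, .refl⟩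

theorem An_subset_Co (G : SMG V) (W : Set V) : G.An W ⊆ G.Co W := by
  rintro v ⟨w, hw, hvw⟩
  refine ⟨w, hw, ?_⟩
  induction hvw using Relation.ReflTransGen.head_induction_on with
  | refl => exact .refl
  | head h _ ih => exact ih.tail (.inr (.inl h))

/-- `G.LatentAncestor K u v`: there is a directed path from `u` to `v`, possibly trivial, on which
all vertices but `v` lie outside `K`. For `v` in `K`, the variables `u` in this relation are those
whose functions get substituted into that of `v` when projecting to `K`, and `v` itself. -/
def LatentAncestor (G : SMG V) (K : Set V) : V → V → Prop :=
  Relation.ReflTransGen fun u v => u ∉ K ∧ G.dir u v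

theorem LatentAncestor.eq_of_mem (h : G.LatentAncestor K u v) (hu : u ∈ K) : u = v :=
  h.cases_head.resolve_right fun ⟨_, huc, _⟩ => huc.1 hu

theorem dirPath_compl_iff :
    G.DirPath Kᶜ a b ↔ ∃ c, G.dir a c ∧ G.LatentAncestor K c b := by
  constructor
  · intro h
    induction h with
    | edge h => exact ⟨_, h, .refl⟩
    | cons h hc _ ih =>
      obtain ⟨d, hcd, hdb⟩ := ih
      exact ⟨_, h, hdb.head ⟨hc, hcd⟩⟩
  · rintro ⟨c, hac, hcb⟩
    induction hcb using Relation.ReflTransGen.head_induction_on generalizing a with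
    | refl => exact .edge hac
    | head h _ ih => exact .cons hac h.1 (ih h.2)

theorem DirPath.latentAncestor (h : G.DirPath Kᶜ a b) (ha : a ∉ K) : G.LatentAncestor K a b :=
  let ⟨_, hac, hcb⟩ := dirPath_compl_iff.1 h
  hcb.head ⟨ha, hac⟩

theorem Mark.eq_fwd_of_not_headAtStart (h : ¬ m.headAtStart) : m = .fwd := by
  cases m with
  | fwd => rfl
  | bwd | bid => exact absurd trivial h

theorem NoColliderPath.dirPath (h : G.NoColliderPath L m a b l) (hm : m = .fwd) :
    G.DirPath L a b := by
  induction h with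
  | edge h => subst hm; exact .edge h
  | cons h hc hn _ ih =>
    subst hm
    exact .cons h hc (ih (Mark.eq_fwd_of_not_headAtStart fun h' => hn ⟨trivial, h'⟩))

/-- A collider-free path first climbs against directed edges, then has at most one bidirected edge,
and finally descends; `u` and `w` are the endpoints of the bidirected edge, or both the peak. -/
theorem NoColliderPath.exists_latentAncestor (h : G.NoColliderPath Kᶜ m a b l)
    (hl : l.headAtEnd) (ha : m.headAtStart ∨ a ∉ K) :
    ∃ u w, (u = w ∨ G.bi u w) ∧ G.LatentAncestor K u a ∧ G.LatentAncestor K w b := by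
  induction h with
  | @edge m a b h =>
    cases m with
    | fwd => exact ⟨a, a, .inl rfl, .refl, .single ⟨ha.resolve_left id, h⟩⟩
    | bwd => exact hl.elim
    | bid => exact ⟨a, b, .inr h, .refl, .refl⟩
  | @cons m m' l a c b h hc hn hp ih =>
    have hdescend (hm : m.headAtEnd) : G.LatentAncestor K c b :=
      (hp.dirPath (Mark.eq_fwd_of_not_headAtStart fun hm' => hn ⟨hm, hm'⟩)).latentAncestor hc
    cases m with
    | fwd => exact ⟨a, a, .inl rfl, .refl, (hdescend trivial).head ⟨ha.resolve_left id, h⟩⟩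
    | bid => exact ⟨a, c, .inr h, .refl, hdescend trivial⟩
    | bwd =>
      obtain ⟨u, w, huw, huc, hwb⟩ := ih hl (.inr hc)
      exact ⟨u, w, huw, huc.tail ⟨hc, h⟩, hwb⟩

theorem NoColliderPath.exists_append (h : G.NoColliderPath Kᶜ m a b l) (hl : l.headAtEnd)
    (hbw : G.LatentAncestor K b w) : ∃ l', l'.headAtEnd ∧ G.NoColliderPath Kᶜ m a w l' := by
  induction hbw using Relation.ReflTransGen.head_induction_on generalizing l with
  | refl => exact ⟨l, hl, h⟩
  | head hbc _ ih => exact ih (h.snoc (l' := .fwd) hbc.1 (fun h' => h'.2) hbc.2) trivial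

theorem NoColliderPath.exists_prepend (h : G.NoColliderPath Kᶜ m a b l) (hm : m.headAtStart)
    (hav : G.LatentAncestor K a v) : ∃ m', m'.headAtStart ∧ G.NoColliderPath Kᶜ m' v b l := by
  induction hav using Relation.ReflTransGen.head_induction_on generalizing m with
  | refl => exact ⟨m, hm, h⟩
  | head hac _ ih => exact ih (.cons (m := .bwd) hac.2 hac.1 (fun h' => h'.1) h) trivial

theorem NoColliderPath.latentProjection_bi {v w : K} (h : G.NoColliderPath Kᶜ m a b l)
    (hm : m.headAtStart) (hl : l.headAtEnd) (hvw : v ≠ w) (hav : G.LatentAncestor K a v)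
    (hbw : G.LatentAncestor K b w) : (G.latentProjection K).bi v w := by
  obtain ⟨l', hl', h'⟩ := h.exists_append hl hbw
  obtain ⟨m', hm', h''⟩ := h'.exists_prepend hm hav
  exact ⟨hvw, m', l', hm', hl', h''⟩

theorem latentProjection_bi_iff {v w : K} (hvw : v ≠ w) :
    (G.latentProjection K).bi v w ↔
      ∃ a b, (a = b ∨ G.bi a b) ∧ G.LatentAncestor K a v ∧ G.LatentAncestor K b w := by
  constructor
  · rintro ⟨-, m, l, hm, hl, h⟩
    exact h.exists_latentAncestor hl (.inl hm)
  · rintro ⟨a, b, rfl | hab, hav, hbw⟩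
    · have ha : a ∉ K := fun ha =>
        hvw (Subtype.ext ((hav.eq_of_mem ha).symm.trans (hbw.eq_of_mem ha)))
      obtain rfl | ⟨c, hac, hcv⟩ := hav.cases_head
      · exact absurd v.2 ha
      obtain rfl | ⟨d, had, hdw⟩ := hbw.cases_head
      · exact absurd w.2 ha
      have hcd : G.NoColliderPath Kᶜ .bwd c d .fwd :=
        .cons (m := .bwd) hac.2 ha (fun h => h.1) (.edge (m := .fwd) had.2)
      exact hcd.latentProjection_bi trivial trivial hvw hcv hdw
    · exact (NoColliderPath.edge (m := .bid) hab).latentProjection_bi trivial trivial hvw hav hbw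

end SMG

namespace CausalModel

variable {V : Type u} {G : SMG V} {D : V → Type} {X Y K S : Set V}

instance (M : CausalModel G D) (i : M.ι) : Nonempty (M.Ω i) :=
  nonempty_of_isProbabilityMeasure (M.law i)

section Values

variable [Finite V] (M : CausalModel G D) {x x' : ∀ v, D v} {ω ω' : ∀ i, M.Ω i} {v : V}

theorem value_of_mem (hv : v ∈ X) : M.value X x ω v = x v := by
  rw [value_eq, if_pos hv]

theorem value_of_notMem (hv : v ∉ X) :
    M.value X x ω v = M.f v (fun p => M.value X x ω p) (fun i => ω i) := by
  rw [value_eq, if_neg hv]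

theorem value_eq_of_forall_mem {g : ∀ v, D v} (hX : ∀ v ∈ S ∩ X, g v = x v)
    (hS : ∀ v ∈ S \ X, ∀ p, G.dir p v → p ∈ S)
    (hf : ∀ v ∈ S \ X, g v = M.f v (fun p => g p) (fun i => ω i)) :
    ∀ v ∈ S, M.value X x ω v = g v := by
  intro v
  induction v using G.wellFounded_dir.induction with
  | _ v ih =>
    intro hvS
    by_cases hvX : v ∈ X
    · rw [M.value_of_mem hvX, hX v ⟨hvS, hvX⟩]
    · rw [M.value_of_notMem hvX, hf v ⟨hvS, hvX⟩]
      congr 1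
      exact funext fun p => ih p p.2 (hS v ⟨hvS, hvX⟩ p p.2)

theorem value_congr (h : ∀ v ∈ X, x v = x' v) : M.value X x ω = M.value X x' ω :=
  funext fun v => M.value_eq_of_forall_mem (S := Set.univ)
    (fun v hv => (M.value_of_mem hv.2).trans (h v hv.2).symm) (fun _ _ _ _ => trivial)
    (fun _ hv => M.value_of_notMem hv.2) v trivial

theorem value_inter (hK : (G.removeIncoming X).An Y ⊆ K) (hv : v ∈ Y) :
    M.value (X ∩ K) x ω v = M.value X x ω v := by
  refine (M.value_eq_of_forall_mem (S := (G.removeIncoming X).An Y) (fun u hu => ?_)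
    (fun u hu p hp => ?_) (fun u hu => ?_) v (SMG.subset_An _ Y hv)).symm
  · exact M.value_of_mem ⟨hu.2, hK hu.1⟩
  · obtain ⟨⟨w, hw, huw⟩, huX⟩ := hu
    exact ⟨w, hw, huw.head ⟨hp, huX⟩⟩
  · exact M.value_of_notMem fun h => hu.2 h.1

/-- Solving the functional equations of `v` and of its latent ancestors only, given the values of
the parents of `v` in the latent projection, yields the value of `v`. -/
theorem value_diff_singleton (hXK : X ⊆ K) (hv : v ∉ X)
    (hx : ∀ p ∈ K, G.DirPath Kᶜ p v → x' p = M.value X x ω p)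
    (hω : ∀ i, (∃ u ∈ M.child i, G.LatentAncestor K u v) → ω' i = ω i) :
    M.value (K \ {v}) x' ω' v = M.value X x ω v := by
  let S : Set V := {u | G.LatentAncestor K u v ∨ u ∈ K ∧ G.DirPath Kᶜ u v}
  have latentAncestor_of_mem : ∀ u ∈ S \ (K \ {v}), G.LatentAncestor K u v := by
    rintro u ⟨hu | ⟨huK, huv⟩, hnot⟩
    · exact hu
    · obtain rfl : u = v := not_not.1 fun h => hnot ⟨huK, h⟩
      exact absurd huv.transGen (G.acyclic u)
  refine M.value_eq_of_forall_mem (S := S) ?_ (fun u hu p hpu => ?_) (fun u hu => ?_) v (.inl .refl)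
  · rintro u ⟨hu | hu, huK, huv⟩
    · exact absurd (hu.eq_of_mem huK) huv
    · exact (hx u huK hu.2).symm
  · have huv := latentAncestor_of_mem u hu
    by_cases hpK : p ∈ K
    · exact .inr ⟨hpK, SMG.dirPath_compl_iff.2 ⟨u, hpu, huv⟩⟩
    · exact .inl (huv.head ⟨hpK, hpu⟩)
  · have huv := latentAncestor_of_mem u hu
    have huX : u ∉ X := fun huX => hv (huv.eq_of_mem (hXK huX) ▸ huX)
    rw [M.value_of_notMem huX]
    congr 1
    exact funext fun i => (hω i ⟨u, i.2, huv⟩).symm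

theorem measurableSet_value_eq [∀ v, Countable (D v)] (X : Set V) (x : ∀ v, D v) (v : V) (d : D v) :
    MeasurableSet {ω | M.value X x ω v = d} := by
  induction v using G.wellFounded_dir.induction with
  | _ v ih =>
    by_cases hv : v ∈ X
    · simp only [M.value_of_mem hv, MeasurableSet.const]
    have hunion : {ω | M.value X x ω v = d} = ⋃ pa : (∀ p : {p // G.dir p v}, D p),
        (⋂ p : {p // G.dir p v}, {ω | M.value X x ω p = pa p}) ∩
          (fun ω (i : {i // v ∈ M.child i}) => ω i) ⁻¹' {ω | M.f v pa ω = d} := by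
      ext ω
      simp only [Set.mem_ofPred_eq, Set.mem_iUnion, Set.mem_inter_iff, Set.mem_iInter,
        Set.mem_preimage, M.value_of_notMem hv]
      constructor
      · exact fun h => ⟨_, fun _ => rfl, h⟩
      · rintro ⟨pa, hpa, rfl⟩
        rw [← funext hpa]
    rw [hunion]
    exact .iUnion fun pa => .inter (.iInter fun p => ih p p.2 _)
      (measurable_pi_iff.2 (fun i => measurable_pi_apply _) (M.measurable_f v pa d))

theorem effect_inter (hK : (G.removeIncoming X).An Y ⊆ K) (x y : ∀ v, D v) :
    M.effect (X ∩ K) x Y y = M.effect X x Y y :=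
  congrArg M.exoLaw <| Set.ext fun _ => forall₂_congr fun _ hv => by rw [M.value_inter hK hv]

theorem prob_eq_tsum [∀ v, Countable (D v)] (K : Set V) (s : ∀ v, D v) :
    M.prob K s = ∑' t : {t : ∀ v, D v | ∀ v ∈ K, t v = s v}, M.prob Set.univ t := by
  have hval (t : ∀ v, D v) (ω) : M.value ∅ s ω = M.value ∅ t ω := M.value_congr fun _ => False.elim
  have hunion : {ω | ∀ v ∈ K, M.value ∅ s ω v = s v} =
      ⋃ t ∈ {t : ∀ v, D v | ∀ v ∈ K, t v = s v}, {ω | ∀ v ∈ Set.univ, M.value ∅ t ω v = t v} := by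
    ext ω
    simp only [Set.mem_ofPred_eq, Set.mem_iUnion, exists_prop, Set.mem_univ, true_imp_iff, ← hval]
    constructor
    · exact fun h => ⟨M.value ∅ s ω, h, fun _ => rfl⟩
    · rintro ⟨t, hts, ht⟩ v hv
      rw [ht, hts v hv]
  unfold prob effect
  rw [hunion, measure_biUnion (Set.to_countable _)]
  · intro t _ t' _ htt'
    refine Set.disjoint_left.2 fun ω h h' => htt' (funext fun v => ?_)
    rw [← h v trivial, ← h' v trivial]
    exact congrFun ((hval t ω).symm.trans (hval t' ω)) v
  · intro t _
    simp only [Set.mem_univ, true_imp_iff, Set.ofPred_forall]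
    exact .iInter fun v => M.measurableSet_value_eq _ _ _ _

theorem prob_anti {K K' : Set V} (h : K ⊆ K') (s : ∀ v, D v) : M.prob K' s ≤ M.prob K s :=
  measure_mono fun _ hω v hv => hω v (h hv)

end Values

section Projection

variable [Fintype V] [∀ v, Countable (D v)] [∀ v, Nonempty (D v)]

/-- The model of the latent projection to `K` obtained by substituting the functions of the
variables outside `K`. Every vertex `u` carries an additional trivial exogenous variable `.inr u`:
a vertex outside `K` need not have exogenous parents in `M`, but in the latent projection the
vertices of which it is a latent ancestor are siblings. -/
noncomputable def project (M : CausalModel G D) (K : Set V) :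
    CausalModel (G.latentProjection K) (fun k => D k) where
  ι := M.ι ⊕ V
  child := Sum.elim (fun i => {v | ∃ u ∈ M.child i, G.LatentAncestor K u v})
    (fun u => {v | G.LatentAncestor K u v})
  Ω := Sum.elim M.Ω fun _ => Unit
  law := sumLaw M.law fun _ => Measure.dirac ()
  f v pa ω := M.value (K \ {(v : V)}) (extendPi (· ∈ K) (extendPi _ pa))
    (extendPi (fun i => ∃ u ∈ M.child i, G.LatentAncestor K u v) fun i => ω ⟨.inl i, i.2⟩) v
  measurable_f v pa d := by
    refine ((measurable_extendPi _).comp (measurable_pi_iff.2 fun i => ?_))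
      (M.measurableSet_value_eq _ _ _ d)
    exact measurable_pi_apply (⟨.inl i, i.2⟩ : {i : M.ι ⊕ V // v ∈ Sum.elim _ _ i})
  bi_iff v w hvw := by
    rw [SMG.latentProjection_bi_iff hvw]
    constructor
    · rintro ⟨a, b, hab, hav, hbw⟩
      by_cases h : a = b
      · exact ⟨.inr a, hav, h ▸ hbw⟩
      · obtain ⟨i, ha, hb⟩ := (M.bi_iff a b h).1 (hab.resolve_left h)
        exact ⟨.inl i, ⟨a, ha, hav⟩, ⟨b, hb, hbw⟩⟩
    · rintro ⟨i | u, hv, hw⟩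
      · obtain ⟨a, ha, hav⟩ := hv
        obtain ⟨b, hb, hbw⟩ := hw
        exact ⟨a, b, or_iff_not_imp_left.2 fun h => (M.bi_iff a b h).2 ⟨i, ha, hb⟩, hav, hbw⟩
      · exact ⟨u, u, .inl rfl, hv, hw⟩

theorem value_project (M : CausalModel G D) (X : Set V) (x : ∀ v, D v)
    (ω : ∀ i, (M.project K).Ω i) (v : K) :
    (M.project K).value (Subtype.val ⁻¹' X) (fun k => x k) ω v =
      M.value (X ∩ K) x (fun i => ω (.inl i)) v := by
  refine (M.project K).value_eq_of_forall_mem (S := Set.univ)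
    (g := fun k => M.value (X ∩ K) x (fun i => ω (.inl i)) k)
    (fun v hv => M.value_of_mem ⟨hv.2, v.2⟩) (fun _ _ _ _ => trivial) (fun v hv => ?_) v trivial
  refine (M.value_diff_singleton Set.inter_subset_right (fun h => hv.2 h.1)
    (fun p hpK hpv => ?_) fun i hi => ?_).symm
  · rw [extendPi_of_pos _ hpK]
    exact extendPi_of_pos (p := fun p => (G.latentProjection K).dir p v) (i := ⟨p, hpK⟩) _ hpv
  · exact extendPi_of_pos (p := fun i => ∃ u ∈ M.child i, G.LatentAncestor K u v) _ hi

theorem effect_project (M : CausalModel G D) (X : Set V) (x : ∀ v, D v) (hY : Y ⊆ K)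
    (y : ∀ v, D v) :
    (M.project K).effect (Subtype.val ⁻¹' X) (fun k => x k) (Subtype.val ⁻¹' Y) (fun k => y k) =
      M.effect (X ∩ K) x Y y := by
  have h := pi_sumLaw M.law (fun _ : V => Measure.dirac ())
    {ω | ∀ v ∈ Y, M.value (X ∩ K) x ω v = y v} Set.univ
  rw [measure_univ, mul_one] at h
  refine Eq.trans (congrArg (M.project K).exoLaw (Set.ext fun ω => ?_)) h
  have hvalue := M.value_project X x ω
  exact ⟨fun hω => ⟨fun v hv => (hvalue ⟨v, hY hv⟩).symm.trans (hω ⟨v, hY hv⟩ hv), trivial⟩,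
    fun hω v hv => (hvalue v).trans (hω.1 v hv)⟩

theorem prob_project (M : CausalModel G D) (s : ∀ v, D v) :
    (M.project K).prob Set.univ (fun k => s k) = M.prob K s := by
  have h := M.effect_project ∅ s (subset_refl K) s
  rwa [Set.preimage_empty, Subtype.coe_preimage_self, Set.empty_inter] at h

theorem effect_project_of_An_subset (M : CausalModel G D) (hK : (G.removeIncoming X).An Y ⊆ K)
    (x y : ∀ v, D v) :
    (M.project K).effect (Subtype.val ⁻¹' X) (fun k => x k) (Subtype.val ⁻¹' Y) (fun k => y k) =
      M.effect X x Y y := by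
  rw [M.effect_project X x ((SMG.subset_An _ Y).trans hK), M.effect_inter hK]

end Projection

section Extension

variable [Fintype V] [∀ v, MeasurableSpace (D v)] [∀ v, MeasurableSingletonClass (D v)]

/-- The children of the exogenous variables of `M.extend ν`: those of a model `M` of `G[K]`, and a
variable `.inr (v, w)` with children `v` and `w` for each `v` outside `K` and each `w` which is `v`
itself or joined to `v` by a bidirected edge. -/
def extendChild (M : CausalModel (G.induce K) (fun k => D k)) : M.ι ⊕ V × V → Set V :=
  Sum.elim (fun i => Subtype.val '' M.child i)
    (fun q => {v | q.1 ∉ K ∧ (q.1 = q.2 ∨ G.bi q.1 q.2) ∧ (v = q.1 ∨ v = q.2)})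

open Classical in
/-- The extension to `G` of a model of `G[K]`, in which each variable `v` outside `K` is independent
noise with law `ν v`, ignored by the variables in `K`. The noise is the exogenous variable
`.inr (v, v)`; the variables `.inr (v, w)` with `v ≠ w` are ignored by all functions and are there
only to give `v` and `w` a common exogenous parent. -/
noncomputable def extend (M : CausalModel (G.induce K) (fun k => D k)) (ν : ∀ v, Measure (D v))
    [∀ v, IsProbabilityMeasure (ν v)] : CausalModel G D where
  ι := M.ι ⊕ V × V
  child := M.extendChild
  Ω := Sum.elim M.Ω fun q => D q.1
  law := sumLaw M.law fun q => ν q.1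
  f v pa ω :=
    if h : v ∈ K then M.f ⟨v, h⟩ (fun p => pa ⟨p, p.2⟩) (fun i => ω ⟨.inl i, ⟨v, h⟩, i.2, rfl⟩)
    else ω ⟨.inr (v, v), h, .inl rfl, .inl rfl⟩
  measurable_f v pa d := by
    by_cases h : v ∈ K
    · have hrestrict : Measurable
          fun (ω : ∀ i : {i // v ∈ M.extendChild i}, Sum.elim M.Ω (fun q : V × V => D q.1) i.1)
            (i : {i // ⟨v, h⟩ ∈ M.child i}) => (ω ⟨.inl i, ⟨v, h⟩, i.2, rfl⟩ : M.Ω i) :=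
        measurable_pi_iff.2 fun i => measurable_pi_apply
          (⟨.inl i, ⟨v, h⟩, i.2, rfl⟩ : {i // v ∈ M.extendChild i})
      convert hrestrict (M.measurable_f ⟨v, h⟩ (fun p => pa ⟨p, p.2⟩) d) using 1
      exact Set.ext fun ω => Eq.congr_left (dif_pos h)
    · have hnoise : Measurable
          fun ω : ∀ i : {i // v ∈ M.extendChild i}, Sum.elim M.Ω (fun q : V × V => D q.1) i.1 =>
            (ω ⟨.inr (v, v), h, .inl rfl, .inl rfl⟩ : D v) :=
        measurable_pi_apply
          (⟨.inr (v, v), h, .inl rfl, .inl rfl⟩ : {i // v ∈ M.extendChild i})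
      convert hnoise (measurableSet_singleton d) using 1
      exact Set.ext fun ω => Eq.congr_left (dif_neg h)
  bi_iff v w hvw := by
    constructor
    · intro h
      by_cases hv : v ∈ K
      · by_cases hw : w ∈ K
        · obtain ⟨i, hi, hi'⟩ := (M.bi_iff ⟨v, hv⟩ ⟨w, hw⟩
            fun h => hvw (congrArg Subtype.val h)).1 h
          exact ⟨.inl i, ⟨_, hi, rfl⟩, ⟨_, hi', rfl⟩⟩
        · have hwv := G.bi_symm v w h
          exact ⟨.inr (w, v), ⟨hw, .inr hwv, .inr rfl⟩, ⟨hw, .inr hwv, .inl rfl⟩⟩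
      · exact ⟨.inr (v, w), ⟨hv, .inr h, .inl rfl⟩, ⟨hv, .inr h, .inr rfl⟩⟩
    · rintro ⟨i | ⟨a, b⟩, hv, hw⟩
      · obtain ⟨v, hv, rfl⟩ := hv
        obtain ⟨w, hw, rfl⟩ := hw
        exact (M.bi_iff v w fun h => hvw (congrArg Subtype.val h)).2 ⟨i, hv, hw⟩
      · obtain ⟨-, hab, rfl | rfl⟩ := hv <;> obtain ⟨-, -, rfl | rfl⟩ := hw
        · exact absurd rfl hvw
        · exact hab.resolve_left hvw
        · exact G.bi_symm _ _ (hab.resolve_left hvw.symm)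
        · exact absurd rfl hvw

variable (M : CausalModel (G.induce K) (fun k => D k)) (ν : ∀ v, Measure (D v))
  [∀ v, IsProbabilityMeasure (ν v)]

theorem value_extend_of_mem (X : Set V) (x : ∀ v, D v) (ω : ∀ i, (M.extend ν).Ω i) (v : K) :
    (M.extend ν).value X x ω v =
      M.value (Subtype.val ⁻¹' X) (fun k => x k) (fun i => ω (.inl i)) v :=
  (M.value_eq_of_forall_mem (S := Set.univ) (ω := fun i => ω (.inl i))
    (g := fun k => (M.extend ν).value X x ω k) (fun _ hv => (M.extend ν).value_of_mem hv.2)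
    (fun _ _ _ _ => trivial) (fun v hv => ((M.extend ν).value_of_notMem hv.2).trans (dif_pos v.2))
    v trivial).symm

theorem value_extend_of_notMem {v : V} (hX : v ∉ X) (hK : v ∉ K) (x : ∀ v, D v)
    (ω : ∀ i, (M.extend ν).Ω i) : (M.extend ν).value X x ω v = ω (.inr (v, v)) :=
  ((M.extend ν).value_of_notMem hX).trans (dif_neg hK)

theorem effect_extend (X : Set V) (x : ∀ v, D v) (hY : Y ⊆ K) (y : ∀ v, D v) :
    (M.extend ν).effect X x Y y = M.effect (Subtype.val ⁻¹' X) (fun k => x k)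
      (Subtype.val ⁻¹' Y) (fun k => y k) := by
  have h := pi_sumLaw M.law (fun q : V × V => ν q.1) {ω | ∀ v ∈ Subtype.val ⁻¹' Y,
    M.value (Subtype.val ⁻¹' X) (fun k => x k) ω v = y v} Set.univ
  rw [measure_univ, mul_one] at h
  refine Eq.trans (congrArg (M.extend ν).exoLaw (Set.ext fun ω => ?_)) h
  have hvalue := M.value_extend_of_mem ν X x ω
  exact ⟨fun hω => ⟨fun v hv => (hvalue v).symm.trans (hω v hv), trivial⟩,
    fun hω v hv => (hvalue ⟨v, hY hv⟩).trans (hω.1 ⟨v, hY hv⟩ hv)⟩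

theorem prob_extend (s : ∀ v, D v) :
    (M.extend ν).prob Set.univ s = M.prob Set.univ (fun k => s k) *
      Measure.pi (fun q : V × V => ν q.1) {η | ∀ v ∉ K, η (v, v) = s v} := by
  refine Eq.trans (congrArg (M.extend ν).exoLaw (Set.ext fun ω => ?_))
    (pi_sumLaw M.law (fun q : V × V => ν q.1) _ _)
  have hvalue := M.value_extend_of_mem ν ∅ s ω
  rw [Set.preimage_empty] at hvalue
  have hnoise (v) (hv : v ∉ K) := M.value_extend_of_notMem ν (Set.notMem_empty v) hv s ω
  constructor
  · exact fun hs => ⟨fun v _ => (hvalue v).symm.trans (hs v trivial),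
      fun v hv => (hnoise v hv).symm.trans (hs v trivial)⟩
  · rintro ⟨hs, hs'⟩ v -
    by_cases hv : v ∈ K
    · exact (hvalue ⟨v, hv⟩).trans (hs ⟨v, hv⟩ trivial)
    · exact (hnoise v hv).trans (hs' v hv)

theorem prob_extend_pos {s : ∀ v, D v} (hM : 0 < M.prob Set.univ (fun k => s k))
    (hν : ∀ v, 0 < ν v {s v}) : 0 < (M.extend ν).prob Set.univ s := by
  rw [prob_extend]
  refine ENNReal.mul_pos hM.ne' (LT.lt.ne' ?_)
  calc 0 < ∏ q : V × V, ν q.1 {s q.1} :=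
        pos_iff_ne_zero.2 (Finset.prod_ne_zero_iff.2 fun q _ => (hν q.1).ne')
    _ = Measure.pi (fun q : V × V => ν q.1) (Set.univ.pi fun q => {s q.1}) :=
        (Measure.pi_pi _ _).symm
    _ ≤ Measure.pi (fun q : V × V => ν q.1) {η | ∀ v ∉ K, η (v, v) = s v} :=
        measure_mono fun η hη v _ => hη (v, v) trivial

end Extension

end CausalModel

namespace SMG

variable {V : Type u} [Finite V] {G : SMG V} {X Y K : Set V}

theorem Identifiable.of_latentProjection (hK : (G.removeIncoming X).An Y ⊆ K)
    (h : (G.latentProjection K).Identifiable (Subtype.val ⁻¹' X) (Subtype.val ⁻¹' Y)) :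
    G.Identifiable X Y := by
  cases nonempty_fintype V
  intro D _ _ M₁ M₂ hprob hpos x y
  rw [← M₁.effect_project_of_An_subset hK, ← M₂.effect_project_of_An_subset hK]
  refine h _ _ _ (fun s => ?_) (fun s => ?_) _ _
  · obtain ⟨s, rfl⟩ := Subtype.exists_pi_extension (α := D) s
    rw [M₁.prob_project, M₂.prob_project, M₁.prob_eq_tsum, M₂.prob_eq_tsum]
    exact tsum_congr fun t => hprob t
  · obtain ⟨s, rfl⟩ := Subtype.exists_pi_extension (α := D) s
    rw [M₁.prob_project]
    exact (hpos s).trans_le (M₁.prob_anti (Set.subset_univ K) s)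

theorem Identifiable.induce (h : G.Identifiable X Y) (hY : Y ⊆ K) :
    (G.induce K).Identifiable (Subtype.val ⁻¹' X) (Subtype.val ⁻¹' Y) := by
  cases nonempty_fintype V
  intro D' _ _ M₁ M₂ hprob hpos x y
  obtain ⟨D, rfl, _, _⟩ := exists_countable_nonempty_extension D'
  obtain ⟨x, rfl⟩ := Subtype.exists_pi_extension (α := D) x
  obtain ⟨y, rfl⟩ := Subtype.exists_pi_extension (α := D) y
  let _ : ∀ v, MeasurableSpace (D v) := fun _ => ⊤
  let ν (v : V) : Measure (D v) := Measure.count.toFinite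
  have hν (v : V) (d : D v) : 0 < ν v {d} := by
    rw [pos_iff_ne_zero, Ne, toFinite_apply_eq_zero_iff, Measure.count_eq_zero_iff]
    exact Set.singleton_ne_empty d
  rw [← M₁.effect_extend ν X x hY y, ← M₂.effect_extend ν X x hY y]
  refine h D _ _ (fun s => ?_) (fun s => M₁.prob_extend_pos ν (hpos _) fun v => hν v _) x y
  rw [M₁.prob_extend, M₂.prob_extend, hprob]

end SMG

theorem mainTheorem3_general {V : Type u} [Finite V] (G : SMG V) (X Y Z : Set V)
    (hZ : (G.removeIncoming X).An Y ⊆ Zᶜ) (hL : G.induce Zᶜ = G.latentProjection Zᶜ) :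
    G.CanBeRemoved X Y Z := by
  cases nonempty_fintype V
  have hY : Y ⊆ Zᶜ := (SMG.subset_An _ Y).trans hZ
  have hinduce : G.Identifiable X Y →
      (G.induce Zᶜ).Identifiable (Subtype.val ⁻¹' X) (Subtype.val ⁻¹' Y) := fun h => h.induce hY
  unfold SMG.CanBeRemoved
  rw [hL] at hinduce ⊢
  refine ⟨hY, fun D _ _ M => ?_, ⟨hinduce, .of_latentProjection hZ⟩, ?_⟩
  · exact ⟨M.project Zᶜ, M.prob_project, fun x y => (M.effect_project_of_An_subset hZ x y).symm⟩
  · intro h D _ _ M M' hprob hpos x y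
    have hprob' : ∀ s, M'.prob Set.univ s = (M.project Zᶜ).prob Set.univ s := fun s => by
      obtain ⟨s, rfl⟩ := Subtype.exists_pi_extension (α := D) s
      rw [M.prob_project, hprob]
    rw [← M.effect_project_of_An_subset hZ]
    exact (hinduce h _ M' _ hprob' hpos _ _).symm

theorem mainTheorem3 {V : Type u} [Finite V] (G : SMG V) (X Y : Set V) (hXY : Disjoint X Y)
    (Z : Set V) (hZ : Z = G.An Y \ (G.removeIncoming X).Co Y)
    (hL : G.induce Zᶜ = G.latentProjection Zᶜ) :
    G.CanBeRemoved X Y Z :=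
  mainTheorem3_general G X Y Z
    (fun _ hv hvZ => (hZ ▸ hvZ).2 (SMG.An_subset_Co (G.removeIncoming X) Y hv)) hL
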